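/- Let $\mathcal X\subset\mathbb R^{d}$ (contexts) and $\Xi\subset\mathbb R^{d'}$ (outcomes) be finite sets and $\mathcal A$ a finite set of actions. Let $P^0$ be a probability distribution on $\mathcal X$; for each $(x,a)\in\mathcal X\times\mathcal A$ let $R^0_{x,a}$ be a probability distribution on $\Xi$ and $y_{x,a}:\Xi\to[0,Y_{\max}]$ a known cost function; and for each $x\in\mathcal X$ let $\pi_0(\cdot\mid x)$ (the behavior policy) be a probability distribution on $\mathcal A$. Assume there are constants $\mu_{\pi_0},\mu_{x_0}>0$ with $\pi_0(a\mid x)\ge\mu_{\pi_0}$ and $P^0(x)\ge\mu_{x_0}$ for all $x\in\mathcal X$, $a\in\mathcal A$. The data are $n$ independent records $(X_i,A_i,\xi_i)$ with $X_i\sim P^0$, $A_i\sim\pi_0(\cdot\mid X_i)$, $\xi_i\sim R^0_{X_i,A_i}$ (the observed cost being $Y_i=y_{X_i,A_i}(\xi_i)$). For distributions $P,Q$ on a finite set $S$ of points of a Euclidean space let $D(P,Q)=\inf_\sigma \mathbb E_{(s,t)\sim\sigma}\|s-t\|^2$, the infimum being over couplings $\sigma$ of $P$ and $Q$, and let $\mathcal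 U(\epsilon;P)$ be the set of distributions $Q$ on $S$ with $D(P,Q)\le\epsilon$. Fix $\epsilon_x,\epsilon_c>0$. For a policy $\pi$ (a map $x\mapsto\pi(\cdot\mid x)$ from $\mathcal X$ to distributions on $\mathcal A$) the robust value is $$V(\pi)=\sup_{P\in\mathcal U(\epsilon_x;P^0)}\mathbb E_{x\sim P}\,\mathbb E_{a\sim\pi(\cdot\mid x)}\Big[\sup_{R\in\mathcal U(\epsilon_c;R^0_{x,a})}\mathbb E_{\xi\sim R}[y_{x,a}(\xi)]\Big],$$ and the empirical robust value is $$\hat V(\pi)=\inf_{\lambda\ge0}\Big\{\epsilon_x\lambda+\mathbb E_{x\sim\hat P}\Big[\max_{\zeta\in\mathcal X}\big(\mathbb E_{a\sim\pi(\cdot\mid\zeta)}[\hat m(\zeta,a)]-\lambda\|x-\zeta\|^2\big)\Big]\Big\},$$ $$\hat m(x,a)=\inf_{\lambda\ge0}\Big\{\epsilon_c\lambda+\mathbb E_{\xi\sim\hat R_{x,a}}\Big[\max_{\zeta\in\Xi}\big(y_{x,a}(\zeta)-\lambda\|\xi-\zeta\|^2\big)\Big]\Big\},$$ where $\hat P$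 is the empirical distribution of $X_1,\dots,X_n$ and $\hat R_{x,a}$ the empirical distribution of those $\xi_i$ with $(X_i,A_i)=(x,a)$. Let $\Pi$ be any non-empty set of policies, $V^*=\inf_{\pi\in\Pi}V(\pi)$ and $\hat V^*=\inf_{\pi\in\Pi}\hat V(\pi)$ (minima whenever these are attained). Let $\delta\in(0,1)$ and $$n\ge\frac{2\log(4|\mathcal X||\mathcal A|/\delta)}{(\mu_{\pi_0}\mu_{x_0})^2}.$$ Then with probability at least $1-\delta$ every pair $(x,a)\in\mathcal X\times\mathcal A$ occurs in the data (so that $\hat V$ is well defined) and $$|\hat V^*-V^*|\le Y_{\max}\left(\sqrt{\frac{2\log(2/\delta)}{n}}+\sqrt{\frac{|\mathcal X|}{n}}+\sqrt{\frac{4\log(4|\mathcal X||\mathcal A|/\delta)}{n\mu_{\pi_0}\mu_{x_0}}}+\sqrt{\frac{2|\Xi|}{n\mu_{\pi_0}\mu_{x_0}}}\right).$$ -/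

import Mathlib

open MeasureTheory ProbabilityTheory
open scoped NNReal

noncomputable section

namespace WassersteinOPL

/-- Expected transport cost `E_{(x,z) ~ σ} |x - z|^2` of a joint distribution `σ` on `S × S`.
For a finite set of points in Euclidean space, `dist` is the Euclidean distance. -/
def transportCost {S : Type*} [Fintype S] [PseudoMetricSpace S]
    (σ : stdSimplex ℝ (S × S)) : ℝ :=
  ∑ x, ∑ z, σ (x, z) * dist x z ^ 2

/-- `σ` is a coupling of the distributions `P` (first marginal) and `Q` (second marginal). -/
def IsCoupling {S : Type*} [Fintype S] (σ : stdSimplex ℝ (S × S)) (P Q : stdSimplex ℝ S) : Prop :=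
  (∀ x, ∑ z, σ (x, z) = P x) ∧ (∀ z, ∑ x, σ (x, z) = Q z)

/-- The Wasserstein distance (optimal transport cost for the cost `|x - z|^2`). -/
def wassersteinDist {S : Type*} [Fintype S] [PseudoMetricSpace S] (P Q : stdSimplex ℝ S) : ℝ :=
  sInf {c | ∃ σ : stdSimplex ℝ (S × S), IsCoupling σ P Q ∧ c = transportCost σ}

/-- The uncertainty set `U(ε; P)`: all distributions on `S` within Wasserstein distance `ε`
of `P`. -/
def uncertaintySet {S : Type*} [Fintype S] [PseudoMetricSpace S] (ε : ℝ) (P : stdSimplex ℝ S) :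
    Set (stdSimplex ℝ S) :=
  {Q | wassersteinDist P Q ≤ ε}

/-- The worst-case expectation `sup_{Q ∈ U(ε; P)} E_Q[f]`. -/
def worstCaseExpectation {S : Type*} [Fintype S] [PseudoMetricSpace S]
    (ε : ℝ) (P : stdSimplex ℝ S) (f : S → ℝ) : ℝ :=
  ⨆ Q : uncertaintySet ε P, ∑ s, (Q : stdSimplex ℝ S) s * f s

/-- The distributionally robust value `V(π)` of a policy `π`, for the context distribution `P`,
the outcome distributions `R x a` and the cost functions `y x a`:
`sup_{P' ∈ U(εx; P)} E_{x ~ P'} E_{a ~ π(·|x)} sup_{R' ∈ U(εc; R x a)} E_{ξ ~ R'} [y x a ξ]`. -/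
def robustValue {𝒳 𝒜 Ξ : Type*} [Fintype 𝒳] [PseudoMetricSpace 𝒳] [Fintype 𝒜]
    [Fintype Ξ] [PseudoMetricSpace Ξ] (εx εc : ℝ)
    (P : stdSimplex ℝ 𝒳) (R : 𝒳 → 𝒜 → stdSimplex ℝ Ξ) (y : 𝒳 → 𝒜 → Ξ → ℝ)
    (π : 𝒳 → stdSimplex ℝ 𝒜) : ℝ :=
  worstCaseExpectation εx P fun x => ∑ a, π x a * worstCaseExpectation εc (R x a) (y x a)

/-- The dual objective value
`inf_{l ≥ 0} (ε l + E_{x ~ p} [sup_z (f z - l |x - z|^2)])`, for a mass function `p` on `S`. -/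
def dualValue {S : Type*} [Fintype S] [PseudoMetricSpace S]
    (ε : ℝ) (p : S → ℝ) (f : S → ℝ) : ℝ :=
  ⨅ l : ℝ≥0, (ε * (l : ℝ) + ∑ x, p x * ⨆ z, (f z - (l : ℝ) * dist x z ^ 2))

open scoped Classical in
/-- The number of records of the dataset with context `x` and action `a`. -/
def pairCount {𝒳 𝒜 Ξ : Type*} {n : ℕ} (D : Fin n → 𝒳 × 𝒜 × Ξ) (x : 𝒳) (a : 𝒜) : ℕ :=
  (Finset.univ.filter fun i => (D i).1 = x ∧ (D i).2.1 = a).card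

open scoped Classical in
/-- The empirical distribution of the contexts. -/
def empContext {𝒳 𝒜 Ξ : Type*} {n : ℕ} (D : Fin n → 𝒳 × 𝒜 × Ξ) (x : 𝒳) : ℝ :=
  ((Finset.univ.filter fun i => (D i).1 = x).card : ℝ) / n

open scoped Classical in
/-- The empirical distribution of the outcome `ξ` among the records with context `x` and
action `a`. It is identically `0` for a pair that does not occur in the dataset. -/
def empOutcome {𝒳 𝒜 Ξ : Type*} {n : ℕ} (D : Fin n → 𝒳 × 𝒜 × Ξ) (x : 𝒳) (a : 𝒜) (ξ : Ξ) : ℝ :=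
  ((Finset.univ.filter fun i => D i = (x, a, ξ)).card : ℝ) / pairCount D x a

/-- The empirical robust value of the policy `π` computed from the dataset `D`, through the
two-step dual problem. -/
def empRobustValue {𝒳 𝒜 Ξ : Type*} [Fintype 𝒳] [PseudoMetricSpace 𝒳] [Fintype 𝒜]
    [Fintype Ξ] [PseudoMetricSpace Ξ] {n : ℕ} (εx εc : ℝ)
    (D : Fin n → 𝒳 × 𝒜 × Ξ) (y : 𝒳 → 𝒜 → Ξ → ℝ) (π : 𝒳 → stdSimplex ℝ 𝒜) : ℝ :=
  dualValue εx (empContext D) fun x =>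
    ∑ a, π x a * dualValue εc (empOutcome D x a) (y x a)

/-- The records `D i = (X_i, A_i, ξ_i)` are measurable, independent, and each of them is
generated by `X_i ~ P`, `A_i ~ π₀(·|X_i)`, `ξ_i ~ R X_i A_i`. (The cost `Y_i` is the function
`y X_i A_i ξ_i` of the record.) -/
structure IsLoggedDataset {Ω : Type*} [MeasurableSpace Ω] (μ : Measure Ω)
    {𝒳 𝒜 Ξ : Type*} [Fintype 𝒳] [MeasurableSpace 𝒳] [Fintype 𝒜] [MeasurableSpace 𝒜]
    [Fintype Ξ] [MeasurableSpace Ξ]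
    (P : stdSimplex ℝ 𝒳) (π₀ : 𝒳 → stdSimplex ℝ 𝒜) (R : 𝒳 → 𝒜 → stdSimplex ℝ Ξ)
    {n : ℕ} (D : Fin n → Ω → 𝒳 × 𝒜 × Ξ) : Prop where
  measurable : ∀ i, Measurable (D i)
  indep : iIndepFun D μ
  law : ∀ i x a ξ, μ.real {ω | D i ω = (x, a, ξ)} = P x * π₀ x a * R x a ξ

end WassersteinOPL

end

/-!
For a penalty `l ≥ 0` the inner maximum `⨆ z, (f z - l * dist x z ^ 2)` is the best value to which a
unit of mass can be moved from `x` at price `l` per unit of cost. A Lagrange multiplier for the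
constraint on the transport cost (a coupling of cost zero is strictly feasible as `ε > 0`) turns a
worst-case expectation into the dual objective, so that `V` and `V̂` are the same functional, the
latter at the empirical distributions. That functional takes values in `[0, Ymax]`, is nonexpansive
in the costs, and is `Ymax`-Lipschitz in total variation, so the error is at most `Ymax` times the
sum of the total variation errors of the contexts and of the outcomes.

A total variation distance is the largest discrepancy over subsets, hence Hoeffding's inequality
and a union bound over the `2 ^ k` subsets control it. The number of records of a pair `(x, a)` is
random, but on the event that it is at least half of its expected minimum, the exponential moment
method applies directly to the sum over those records.
-/

namespace WassersteinOPL

section Simplex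

variable {S T : Type*} [Fintype S] [Fintype T]

theorem sum_mul_mem_Icc {p f : S → ℝ} {a b : ℝ} (hp : p ∈ stdSimplex ℝ S)
    (hf : ∀ s, f s ∈ Set.Icc a b) : ∑ s, p s * f s ∈ Set.Icc a b :=
  (convex_Icc a b).sum_mem (fun s _ => hp.1 s) hp.2 fun s _ => hf s

theorem abs_sum_mul_sub_sum_mul_le {p f g : S → ℝ} {b : ℝ} (hp : p ∈ stdSimplex ℝ S)
    (h : ∀ s, |f s - g s| ≤ b) : |∑ s, p s * f s - ∑ s, p s * g s| ≤ b := by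
  simpa only [Pi.sub_apply, mul_sub, Finset.sum_sub_distrib, Set.mem_Icc, ← abs_le] using
    sum_mul_mem_Icc (f := f - g) hp fun s => abs_le.1 (h s)

theorem sum_stdSimplex_map_mul (φ : S → T) (P : stdSimplex ℝ S) (g : T → ℝ) :
    ∑ t, stdSimplex.map φ P t * g t = ∑ s, P s * g (φ s) := by
  classical
  simp only [stdSimplex.map_coe, FunOnFinite.linearMap_apply_apply, Finset.sum_mul]
  rw [← Finset.sum_fiberwise Finset.univ φ fun s => P s * g (φ s)]
  refine Finset.sum_congr rfl fun t _ => Finset.sum_congr rfl fun s hs => ?_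
  rw [(Finset.mem_filter.1 hs).2]

theorem nonempty_of_stdSimplex (p : stdSimplex ℝ S) : Nonempty S := by
  by_contra h
  rw [not_nonempty_iff] at h
  simpa using stdSimplex.sum_eq_one p

/-- The total variation distance between two mass functions on a finite type. -/
noncomputable def tvDist (p q : S → ℝ) : ℝ :=
  (∑ s, |p s - q s|) / 2

theorem abs_sum_mul_sub_sum_mul_le_tvDist {p q h : S → ℝ} {a b : ℝ} (hp : p ∈ stdSimplex ℝ S)
    (hq : q ∈ stdSimplex ℝ S) (hh : ∀ s, h s ∈ Set.Icc a b) :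
    |∑ s, p s * h s - ∑ s, q s * h s| ≤ (b - a) * tvDist p q := by
  -- `p - q` has total mass zero, so `h` may be centered at the midpoint of `[a, b]`.
  have centered : ∑ s, p s * h s - ∑ s, q s * h s = ∑ s, (p s - q s) * (h s - (a + b) / 2) := by
    simp only [sub_mul, mul_sub, Finset.sum_sub_distrib, ← Finset.sum_mul, hp.2, hq.2]
    ring
  have midpoint : ∀ s, |h s - (a + b) / 2| ≤ (b - a) / 2 := fun s => by
    obtain ⟨ha, hb⟩ := hh s
    rw [abs_le]
    constructor <;> linarith
  calc |∑ s, p s * h s - ∑ s, q s * h s|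
      ≤ ∑ s, |p s - q s| * |h s - (a + b) / 2| := by
        simpa only [centered, abs_mul] using
          Finset.abs_sum_le_sum_abs (fun s => (p s - q s) * (h s - (a + b) / 2)) Finset.univ
    _ ≤ ∑ s, |p s - q s| * ((b - a) / 2) := by gcongr with s; exact midpoint s
    _ = (b - a) * tvDist p q := by rw [← Finset.sum_mul, tvDist]; ring

theorem exists_sum_sub_sum_eq_tvDist {p q : S → ℝ} (hp : p ∈ stdSimplex ℝ S)
    (hq : q ∈ stdSimplex ℝ S) : ∃ T : Finset S, ∑ s ∈ T, p s - ∑ s ∈ T, q s = tvDist p q := by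
  classical
  refine ⟨Finset.univ.filter fun s => q s ≤ p s, ?_⟩
  have positive_part : ∀ s, (if q s ≤ p s then p s - q s else 0)
      = (|p s - q s| + (p s - q s)) / 2 := fun s => by
    split_ifs with h
    · rw [abs_of_nonneg (sub_nonneg.2 h)]; ring
    · rw [abs_of_neg (sub_neg.2 (not_le.1 h))]; ring
  rw [← Finset.sum_sub_distrib, Finset.sum_filter, Finset.sum_congr rfl fun s _ => positive_part s,
    ← Finset.sum_div, Finset.sum_add_distrib, Finset.sum_sub_distrib, hp.2, hq.2, sub_self,
    add_zero, tvDist]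

end Simplex

section LagrangeMultiplier

variable {E : Type*} [AddCommGroup E] [Module ℝ E] {K : Set E} {c v : E → ℝ} {ε V : ℝ}

theorem mul_le_mul_of_convexOn_of_concaveOn (hc : ConvexOn ℝ K c) (hv : ConcaveOn ℝ K v)
    (hV : ∀ x ∈ K, c x ≤ ε → v x ≤ V) {x y : E} (hx : x ∈ K) (hy : y ∈ K) (hxε : c x < ε)
    (hyε : ε < c y) : (v y - V) * (ε - c x) ≤ (V - v x) * (c y - ε) := by
  -- The point of the segment `[x, y]` with these weights has cost at most `ε`.
  set α := (c y - ε) / (c y - c x)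
  set β := (ε - c x) / (c y - c x)
  have hyx : 0 < c y - c x := by linarith
  have hα : 0 ≤ α := div_nonneg (sub_nonneg.2 hyε.le) hyx.le
  have hβ : 0 ≤ β := div_nonneg (sub_nonneg.2 hxε.le) hyx.le
  have hαβ : α + β = 1 := by rw [← add_div, sub_add_sub_cancel, div_self hyx.ne']
  have cost_le : c (α • x + β • y) ≤ ε := calc
    c (α • x + β • y) ≤ α • c x + β • c y := hc.2 hx hy hα hβ hαβ
    _ = ε := by simp only [smul_eq_mul, α, β]; field_simp; ring
  have value_le : α • v x + β • v y ≤ V :=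
    (hv.2 hx hy hα hβ hαβ).trans (hV _ (hc.1 hx hy hα hβ hαβ) cost_le)
  have cleared : ((c y - ε) * v x + (ε - c x) * v y) / (c y - c x) ≤ V := by
    convert value_le using 1
    simp only [smul_eq_mul, α, β]
    ring
  rw [div_le_iff₀ hyx] at cleared
  linarith

theorem exists_lagrangeMultiplier (hc : ConvexOn ℝ K c) (hv : ConcaveOn ℝ K v)
    (slater : ∃ x ∈ K, c x < ε) (hV : ∀ x ∈ K, c x ≤ ε → v x ≤ V) :
    ∃ l : ℝ≥0, ∀ x ∈ K, v x ≤ V + l * (c x - ε) := by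
  let slopes : Set ℝ := (fun x => (V - v x) / (ε - c x)) '' {x ∈ K | c x < ε}
  have slopes_nonneg : ∀ r ∈ slopes, 0 ≤ r := by
    rintro _ ⟨x, ⟨hx, hxε⟩, rfl⟩
    exact div_nonneg (sub_nonneg.2 (hV x hx hxε.le)) (sub_nonneg.2 hxε.le)
  have slopes_nonempty : slopes.Nonempty := Set.Nonempty.image _ slater
  refine ⟨⟨sInf slopes, Real.sInf_nonneg slopes_nonneg⟩, fun x hx => ?_⟩
  change v x ≤ V + sInf slopes * (c x - ε)
  rcases lt_trichotomy (c x) ε with hxε | hxε | hxε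
  · have : sInf slopes ≤ (V - v x) / (ε - c x) := csInf_le ⟨0, slopes_nonneg⟩ ⟨x, ⟨hx, hxε⟩, rfl⟩
    rw [le_div_iff₀ (sub_pos.2 hxε)] at this
    linarith
  · rw [hxε, sub_self, mul_zero, add_zero]
    exact hV x hx hxε.le
  · have : (v x - V) / (c x - ε) ≤ sInf slopes := by
      refine le_csInf slopes_nonempty ?_
      rintro _ ⟨z, ⟨hz, hzε⟩, rfl⟩
      rw [div_le_div_iff₀ (sub_pos.2 hxε) (sub_pos.2 hzε)]
      exact mul_le_mul_of_convexOn_of_concaveOn hc hv hV hz hx hzε hxε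
    rw [div_le_iff₀ (sub_pos.2 hxε)] at this
    linarith

end LagrangeMultiplier

section Coupling

variable {S : Type*} [Fintype S]

theorem stdSimplex_map_fst_apply (σ : stdSimplex ℝ (S × S)) (x : S) :
    stdSimplex.map Prod.fst σ x = ∑ z, σ (x, z) := by
  classical
  simpa [Pi.single_apply, Fintype.sum_prod_type_right] using
    sum_stdSimplex_map_mul Prod.fst σ (Pi.single x 1)

theorem stdSimplex_map_snd_apply (σ : stdSimplex ℝ (S × S)) (z : S) :
    stdSimplex.map Prod.snd σ z = ∑ x, σ (x, z) := by
  classical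
  simpa [Pi.single_apply, Fintype.sum_prod_type] using
    sum_stdSimplex_map_mul Prod.snd σ (Pi.single z 1)

theorem isCoupling_iff_map {σ : stdSimplex ℝ (S × S)} {P Q : stdSimplex ℝ S} :
    IsCoupling σ P Q ↔ stdSimplex.map Prod.fst σ = P ∧ stdSimplex.map Prod.snd σ = Q := by
  simp only [IsCoupling, ← stdSimplex_map_fst_apply, ← stdSimplex_map_snd_apply,
    stdSimplex.ext_iff, funext_iff]

theorem exists_isCoupling (P Q : stdSimplex ℝ S) : ∃ σ, IsCoupling σ P Q := by
  refine ⟨⟨fun q => P q.1 * Q q.2, fun q => mul_nonneg (P.2.1 _) (Q.2.1 _), ?_⟩, ?_, ?_⟩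
  · simp [Fintype.sum_prod_type, ← Finset.mul_sum]
  · exact fun x => by
      change ∑ z, P x * Q z = P x
      rw [← Finset.mul_sum, stdSimplex.sum_eq_one, mul_one]
  · exact fun z => by
      change ∑ x, P x * Q z = Q z
      rw [← Finset.sum_mul, stdSimplex.sum_eq_one, one_mul]

theorem isCoupling_map_graph (P : stdSimplex ℝ S) (g : S → S) :
    IsCoupling (stdSimplex.map (fun x => (x, g x)) P) P (stdSimplex.map g P) := by
  simp only [isCoupling_iff_map, stdSimplex.map_comp_apply]
  exact ⟨stdSimplex.map_id_apply P, rfl⟩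

theorem convex_setOf_marginal_eq (P : stdSimplex ℝ S) :
    Convex ℝ {σ ∈ stdSimplex ℝ (S × S) | ∀ x, ∑ z, σ (x, z) = P x} := by
  rintro σ ⟨hσ, hσP⟩ τ ⟨hτ, hτP⟩ a b ha hb hab
  refine ⟨convex_stdSimplex ℝ _ hσ hτ ha hb hab, fun x => ?_⟩
  simp only [Pi.add_apply, Pi.smul_apply, smul_eq_mul, Finset.sum_add_distrib, ← Finset.mul_sum,
    hσP, hτP, ← add_mul, hab, one_mul]

variable [PseudoMetricSpace S]

theorem transportCost_eq_sum (σ : stdSimplex ℝ (S × S)) :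
    transportCost σ = ∑ q, σ q * dist q.1 q.2 ^ 2 :=
  (Fintype.sum_prod_type' fun x z => σ (x, z) * dist x z ^ 2).symm

theorem transportCost_nonneg (σ : stdSimplex ℝ (S × S)) : 0 ≤ transportCost σ := by
  rw [transportCost_eq_sum]
  exact Finset.sum_nonneg fun q _ => mul_nonneg (σ.2.1 q) (sq_nonneg _)

theorem wassersteinDist_le_transportCost {σ : stdSimplex ℝ (S × S)} {P Q : stdSimplex ℝ S}
    (h : IsCoupling σ P Q) : wassersteinDist P Q ≤ transportCost σ := by
  refine csInf_le ⟨0, ?_⟩ ⟨σ, h, rfl⟩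
  rintro _ ⟨σ', -, rfl⟩
  exact transportCost_nonneg σ'

theorem le_mul_wassersteinDist {P Q : stdSimplex ℝ S} {l r : ℝ} (hl : 0 ≤ l)
    (h : ∀ σ, IsCoupling σ P Q → r ≤ l * transportCost σ) : r ≤ l * wassersteinDist P Q := by
  obtain ⟨σ₀, hσ₀⟩ := exists_isCoupling P Q
  rw [wassersteinDist, ← smul_eq_mul, ← Real.sInf_smul_of_nonneg hl]
  refine le_csInf (Set.Nonempty.smul_set ⟨_, σ₀, hσ₀, rfl⟩) ?_
  rintro _ ⟨_, ⟨σ, hσ, rfl⟩, rfl⟩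
  exact h σ hσ

theorem transportCost_map_graph (P : stdSimplex ℝ S) (g : S → S) :
    transportCost (stdSimplex.map (fun x => (x, g x)) P) = ∑ x, P x * dist x (g x) ^ 2 := by
  rw [transportCost_eq_sum]
  exact sum_stdSimplex_map_mul _ P fun q : S × S => dist q.1 q.2 ^ 2

theorem self_mem_uncertaintySet {ε : ℝ} (hε : 0 ≤ ε) (P : stdSimplex ℝ S) :
    P ∈ uncertaintySet ε P := calc
  wassersteinDist P P ≤ transportCost (stdSimplex.map (fun x => (x, x)) P) :=
    wassersteinDist_le_transportCost (by simpa using isCoupling_map_graph P id)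
  _ = 0 := by simp [transportCost_map_graph P fun x => x]
  _ ≤ ε := hε

end Coupling

section Duality

variable {S : Type*} [PseudoMetricSpace S]

/-- The `c`-transform of `f` for the transport cost `l * dist x z ^ 2`: the inner maximum of the
dual problem `dualValue`. -/
noncomputable def cTransform (l : ℝ) (f : S → ℝ) (x : S) : ℝ :=
  ⨆ z, (f z - l * dist x z ^ 2)

section Finite

variable [Finite S] {l : ℝ} {f g : S → ℝ}

theorem sub_le_cTransform (l : ℝ) (f : S → ℝ) (x z : S) :
    f z - l * dist x z ^ 2 ≤ cTransform l f x :=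
  le_ciSup (f := fun z => f z - l * dist x z ^ 2) (Set.finite_range _).bddAbove z

theorem le_cTransform (l : ℝ) (f : S → ℝ) (x : S) : f x ≤ cTransform l f x := by
  simpa using sub_le_cTransform l f x x

theorem exists_cTransform_eq (l : ℝ) (f : S → ℝ) (x : S) :
    ∃ z, f z - l * dist x z ^ 2 = cTransform l f x :=
  have : Nonempty S := ⟨x⟩
  exists_eq_ciSup_of_finite

theorem cTransform_mem_Icc {a b : ℝ} (hl : 0 ≤ l) (hf : ∀ s, f s ∈ Set.Icc a b) (x : S) :
    cTransform l f x ∈ Set.Icc a b := by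
  refine ⟨(hf x).1.trans (le_cTransform l f x), ?_⟩
  obtain ⟨z, hz⟩ := exists_cTransform_eq l f x
  rw [← hz]
  exact (sub_le_self _ (by positivity)).trans (hf z).2

theorem abs_cTransform_sub_cTransform_le {b : ℝ} (h : ∀ s, |f s - g s| ≤ b) (x : S) :
    |cTransform l f x - cTransform l g x| ≤ b := by
  obtain ⟨z, hz⟩ := exists_cTransform_eq l f x
  obtain ⟨w, hw⟩ := exists_cTransform_eq l g x
  have hfg := (abs_le.1 (h z)).2
  have hgf := (abs_le.1 (h w)).1
  have hzg := sub_le_cTransform l g x z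
  have hwf := sub_le_cTransform l f x w
  rw [abs_le]
  constructor <;> linarith

end Finite

variable [Fintype S] {ε : ℝ}

theorem sum_mul_le_of_isCoupling {σ : stdSimplex ℝ (S × S)} {P Q : stdSimplex ℝ S}
    (h : IsCoupling σ P Q) (l : ℝ) (f : S → ℝ) :
    ∑ s, Q s * f s ≤ l * transportCost σ + ∑ s, P s * cTransform l f s := by
  obtain ⟨rfl, rfl⟩ := isCoupling_iff_map.1 h
  rw [sum_stdSimplex_map_mul, sum_stdSimplex_map_mul, transportCost_eq_sum, Finset.mul_sum,
    ← Finset.sum_add_distrib]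
  refine Finset.sum_le_sum fun q _ => ?_
  calc σ q * f q.2 ≤ σ q * (l * dist q.1 q.2 ^ 2 + cTransform l f q.1) :=
        mul_le_mul_of_nonneg_left (sub_le_iff_le_add'.1 (sub_le_cTransform l f q.1 q.2)) (σ.2.1 q)
    _ = l * (σ q * dist q.1 q.2 ^ 2) + σ q * cTransform l f q.1 := by ring

theorem sum_mul_le_of_mem_uncertaintySet {P Q : stdSimplex ℝ S} (hQ : Q ∈ uncertaintySet ε P)
    (l : ℝ≥0) (f : S → ℝ) :
    ∑ s, Q s * f s ≤ ε * l + ∑ s, P s * cTransform l f s := by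
  have distance_bound : ∑ s, Q s * f s - ∑ s, P s * cTransform l f s ≤ l * wassersteinDist P Q :=
    le_mul_wassersteinDist l.coe_nonneg fun σ hσ =>
      sub_le_iff_le_add.2 (sum_mul_le_of_isCoupling hσ l f)
  have := mul_le_mul_of_nonneg_left hQ l.coe_nonneg
  linarith

theorem sum_mul_le_worstCaseExpectation {P Q : stdSimplex ℝ S} (hQ : Q ∈ uncertaintySet ε P)
    (f : S → ℝ) : ∑ s, Q s * f s ≤ worstCaseExpectation ε P f := by
  refine le_ciSup (f := fun Q : uncertaintySet ε P => ∑ s, (Q : stdSimplex ℝ S) s * f s)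
    ⟨ε * (0 : ℝ≥0) + ∑ s, P s * cTransform (0 : ℝ≥0) f s, ?_⟩ ⟨Q, hQ⟩
  rintro _ ⟨Q', rfl⟩
  exact sum_mul_le_of_mem_uncertaintySet Q'.2 0 f

theorem exists_lagrangeMultiplier_uncertaintySet (hε : 0 < ε) (P : stdSimplex ℝ S) (f : S → ℝ) :
    ∃ l : ℝ≥0, ∀ σ : stdSimplex ℝ (S × S), stdSimplex.map Prod.fst σ = P →
      ∑ q, σ q * f q.2 ≤ worstCaseExpectation ε P f + l * (transportCost σ - ε) := by
  let cost := Fintype.linearCombination ℝ fun q : S × S => dist q.1 q.2 ^ 2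
  let value := Fintype.linearCombination ℝ fun q : S × S => f q.2
  have hK := convex_setOf_marginal_eq P
  have mem_iff : ∀ σ : stdSimplex ℝ (S × S), stdSimplex.map Prod.fst σ = P ↔
      ∀ x, ∑ z, σ (x, z) = P x := fun σ => by
    simp only [stdSimplex.ext_iff, funext_iff, stdSimplex_map_fst_apply]
  have cost_eq : ∀ σ : stdSimplex ℝ (S × S), cost σ = transportCost σ := fun σ =>
    (transportCost_eq_sum σ).symm
  have slater : cost (stdSimplex.map (fun x => (x, x)) P) < ε := by
    rw [cost_eq, transportCost_map_graph P fun x => x]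
    simpa using hε
  have feasible : ∀ σ ∈ {σ ∈ stdSimplex ℝ (S × S) | ∀ x, ∑ z, σ (x, z) = P x},
      cost σ ≤ ε → value σ ≤ worstCaseExpectation ε P f := by
    rintro σ ⟨hσ, marginal⟩ cost_le
    lift σ to stdSimplex ℝ (S × S) using hσ
    have coupling : IsCoupling σ P (stdSimplex.map Prod.snd σ) :=
      isCoupling_iff_map.2 ⟨(mem_iff σ).2 marginal, rfl⟩
    have hQ : stdSimplex.map Prod.snd σ ∈ uncertaintySet ε P :=
      (wassersteinDist_le_transportCost coupling).trans ((cost_eq σ).symm.trans_le cost_le)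
    exact (sum_stdSimplex_map_mul Prod.snd σ f).symm.trans_le (sum_mul_le_worstCaseExpectation hQ f)
  obtain ⟨l, hl⟩ := exists_lagrangeMultiplier (cost.convexOn hK) (value.concaveOn hK)
    ⟨_, ⟨Subtype.property _, (isCoupling_map_graph P id).1⟩, slater⟩ feasible
  exact ⟨l, fun σ hσ => cost_eq σ ▸ hl σ ⟨σ.2, (mem_iff σ).1 hσ⟩⟩

theorem dualObjective_bddBelow {p : S → ℝ} (hε : 0 ≤ ε) (hp : p ∈ stdSimplex ℝ S) (f : S → ℝ) :
    BddBelow (Set.range fun l : ℝ≥0 => ε * l + ∑ s, p s * cTransform l f s) := by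
  refine ⟨∑ s, p s * f s, ?_⟩
  rintro _ ⟨l, rfl⟩
  refine le_add_of_nonneg_of_le (mul_nonneg hε l.2) (Finset.sum_le_sum fun s _ => ?_)
  exact mul_le_mul_of_nonneg_left (le_cTransform l f s) (hp.1 s)

theorem worstCaseExpectation_eq_dualValue (hε : 0 < ε) (P : stdSimplex ℝ S) (f : S → ℝ) :
    worstCaseExpectation ε P f = dualValue ε P f := by
  have : Nonempty (uncertaintySet ε P) := ⟨⟨P, self_mem_uncertaintySet hε.le P⟩⟩
  refine le_antisymm
    (ciSup_le fun Q => le_ciInf fun l => sum_mul_le_of_mem_uncertaintySet Q.2 l f) ?_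
  obtain ⟨l, hl⟩ := exists_lagrangeMultiplier_uncertaintySet hε P f
  choose g hg using exists_cTransform_eq l f
  have dual_le := hl _ (isCoupling_iff_map.1 (isCoupling_map_graph P g)).1
  rw [transportCost_map_graph, sum_stdSimplex_map_mul _ _ fun q : S × S => f q.2] at dual_le
  have attained : ∑ s, P s * cTransform l f s =
      ∑ s, P s * f (g s) - l * ∑ s, P s * dist s (g s) ^ 2 := by
    simp only [← hg, mul_sub, Finset.sum_sub_distrib, Finset.mul_sum, mul_left_comm]
  calc dualValue ε P f ≤ ε * l + ∑ s, P s * cTransform l f s :=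
        ciInf_le (dualObjective_bddBelow hε.le P.2 f) l
    _ ≤ worstCaseExpectation ε P f := by linarith

end Duality

section Stability

theorem abs_iInf_sub_iInf_le {ι : Type*} [Nonempty ι] {f g : ι → ℝ} {b : ℝ}
    (hf : BddBelow (Set.range f)) (hg : BddBelow (Set.range g)) (h : ∀ i, |f i - g i| ≤ b) :
    |(⨅ i, f i) - ⨅ i, g i| ≤ b := by
  have hfg : (⨅ i, f i) - b ≤ ⨅ i, g i :=
    le_ciInf fun i => by linarith [ciInf_le hf i, (abs_le.1 (h i)).2]
  have hgf : (⨅ i, g i) - b ≤ ⨅ i, f i :=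
    le_ciInf fun i => by linarith [ciInf_le hg i, (abs_le.1 (h i)).1]
  rw [abs_le]
  constructor <;> linarith

variable {S : Type*} [Fintype S] [PseudoMetricSpace S] {ε a b : ℝ} {p q f g : S → ℝ}

theorem dualValue_mem_Icc (hε : 0 ≤ ε) (hp : p ∈ stdSimplex ℝ S)
    (hf : ∀ s, f s ∈ Set.Icc a b) : dualValue ε p f ∈ Set.Icc a b := by
  have transform_mem : ∀ l : ℝ≥0, ∑ s, p s * cTransform l f s ∈ Set.Icc a b := fun l =>
    sum_mul_mem_Icc hp (cTransform_mem_Icc l.coe_nonneg hf)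
  refine ⟨le_ciInf fun l => (transform_mem l).1.trans (le_add_of_nonneg_left ?_), ?_⟩
  · exact mul_nonneg hε l.coe_nonneg
  · calc dualValue ε p f ≤ ε * (0 : ℝ≥0) + ∑ s, p s * cTransform (0 : ℝ≥0) f s :=
          ciInf_le (dualObjective_bddBelow hε hp f) 0
      _ = ∑ s, p s * cTransform (0 : ℝ≥0) f s := by rw [NNReal.coe_zero, mul_zero, zero_add]
      _ ≤ b := (transform_mem 0).2

theorem sum_mul_dualValue_mem_Icc {𝒜 : Type*} [Fintype 𝒜] {r f : 𝒜 → S → ℝ} (hε : 0 ≤ ε)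
    (hr : ∀ i, r i ∈ stdSimplex ℝ S) (hf : ∀ i s, f i s ∈ Set.Icc a b) (w : stdSimplex ℝ 𝒜) :
    ∑ i, w i * dualValue ε (r i) (f i) ∈ Set.Icc a b :=
  sum_mul_mem_Icc w.2 fun i => dualValue_mem_Icc hε (hr i) (hf i)

theorem abs_dualValue_sub_dualValue_le (hε : 0 ≤ ε) (hp : p ∈ stdSimplex ℝ S)
    (h : ∀ s, |f s - g s| ≤ b) : |dualValue ε p f - dualValue ε p g| ≤ b := by
  refine abs_iInf_sub_iInf_le (dualObjective_bddBelow hε hp f) (dualObjective_bddBelow hε hp g)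
    fun l => ?_
  rw [add_sub_add_left_eq_sub]
  exact abs_sum_mul_sub_sum_mul_le hp (abs_cTransform_sub_cTransform_le h)

theorem abs_dualValue_sub_dualValue_le_tvDist (hε : 0 ≤ ε) (hp : p ∈ stdSimplex ℝ S)
    (hq : q ∈ stdSimplex ℝ S) (hf : ∀ s, f s ∈ Set.Icc a b) :
    |dualValue ε p f - dualValue ε q f| ≤ (b - a) * tvDist p q := by
  refine abs_iInf_sub_iInf_le (dualObjective_bddBelow hε hp f) (dualObjective_bddBelow hε hq f)
    fun l => ?_
  rw [add_sub_add_left_eq_sub]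
  exact abs_sum_mul_sub_sum_mul_le_tvDist hp hq (cTransform_mem_Icc l.coe_nonneg hf)

end Stability

section EmpiricalDistribution

variable {𝒳 𝒜 Ξ : Type*} {n : ℕ}

open scoped Classical in
/-- The number of records of the dataset `D` that lie in `E`. -/
noncomputable def hitCount {T : Type*} (D : Fin n → T) (E : Set T) : ℕ :=
  (Finset.univ.filter fun i => D i ∈ E).card

theorem natCast_hitCount {T : Type*} (D : Fin n → T) (E : Set T) :
    (hitCount D E : ℝ) = ∑ i, E.indicator 1 (D i) := by
  classical
  simp [hitCount, Set.indicator_apply]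

theorem hitCount_univ {T : Type*} (D : Fin n → T) : hitCount D Set.univ = n := by
  simp [hitCount]

theorem hitCount_inter_add_hitCount_inter_compl {T : Type*} (D : Fin n → T) (E F : Set T) :
    hitCount D (E ∩ F) + hitCount D (E ∩ Fᶜ) = hitCount D E := by
  classical
  simp only [hitCount, Set.mem_inter_iff, Set.mem_compl_iff, ← Finset.filter_filter]
  exact Finset.card_filter_add_card_filter_not _

/-- The records with context `x` and action `a`. -/
def pairEvent (Ξ : Type*) (x : 𝒳) (a : 𝒜) : Set (𝒳 × 𝒜 × Ξ) :=
  {r | r.1 = x ∧ r.2.1 = a}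

theorem pairCount_eq_hitCount (D : Fin n → 𝒳 × 𝒜 × Ξ) (x : 𝒳) (a : 𝒜) :
    pairCount D x a = hitCount D (pairEvent Ξ x a) := by
  unfold pairCount hitCount
  congr!

/-- The relative frequencies of the values of `g` among the records of `D` that lie in `E`; both
`empContext` and `empOutcome` are of this form. -/
noncomputable def condFrequency {T S : Type*} (D : Fin n → T) (E : Set T) (g : T → S) (s : S) : ℝ :=
  hitCount D (E ∩ g ⁻¹' {s}) / hitCount D E

theorem sum_condFrequency {T S : Type*} (D : Fin n → T) (E : Set T) (g : T → S) (A : Finset S) :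
    ∑ s ∈ A, condFrequency D E g s = hitCount D (E ∩ g ⁻¹' A) / hitCount D E := by
  classical
  simp only [condFrequency, natCast_hitCount, ← Finset.sum_div]
  rw [Finset.sum_comm]
  simp [Set.indicator_apply, ite_and]

theorem condFrequency_mem_stdSimplex {T S : Type*} [Fintype S] {D : Fin n → T} {E : Set T}
    (h : 0 < hitCount D E) (g : T → S) : condFrequency D E g ∈ stdSimplex ℝ S := by
  refine ⟨fun s => by unfold condFrequency; positivity, ?_⟩
  simp [sum_condFrequency, h.ne']

theorem empContext_eq_condFrequency (D : Fin n → 𝒳 × 𝒜 × Ξ) :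
    empContext D = condFrequency D Set.univ Prod.fst := by
  classical
  ext x
  simp [empContext, condFrequency, hitCount]

theorem empOutcome_eq_condFrequency (D : Fin n → 𝒳 × 𝒜 × Ξ) (x : 𝒳) (a : 𝒜) :
    empOutcome D x a = condFrequency D (pairEvent Ξ x a) fun r => r.2.2 := by
  classical
  ext ξ
  simp [empOutcome, condFrequency, pairCount_eq_hitCount, hitCount, pairEvent, Prod.ext_iff,
    and_assoc]

theorem empContext_mem_stdSimplex [Fintype 𝒳] (hn : 0 < n) (D : Fin n → 𝒳 × 𝒜 × Ξ) :
    empContext D ∈ stdSimplex ℝ 𝒳 := by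
  rw [empContext_eq_condFrequency]
  exact condFrequency_mem_stdSimplex (by rwa [hitCount_univ]) _

theorem empOutcome_mem_stdSimplex [Fintype Ξ] {D : Fin n → 𝒳 × 𝒜 × Ξ} {x : 𝒳} {a : 𝒜}
    (h : 0 < pairCount D x a) : empOutcome D x a ∈ stdSimplex ℝ Ξ := by
  rw [empOutcome_eq_condFrequency]
  exact condFrequency_mem_stdSimplex (by rwa [← pairCount_eq_hitCount]) _

end EmpiricalDistribution

section RobustValue

variable {𝒳 𝒜 Ξ : Type*} [Fintype 𝒳] [PseudoMetricSpace 𝒳] [Fintype 𝒜]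
  [Fintype Ξ] [PseudoMetricSpace Ξ] {n : ℕ} {εx εc Y s t : ℝ} {y : 𝒳 → 𝒜 → Ξ → ℝ}
  {P : stdSimplex ℝ 𝒳} {R : 𝒳 → 𝒜 → stdSimplex ℝ Ξ} {D : Fin n → 𝒳 × 𝒜 × Ξ}

theorem robustValue_eq_dualValue (hεx : 0 < εx) (hεc : 0 < εc) (P : stdSimplex ℝ 𝒳)
    (R : 𝒳 → 𝒜 → stdSimplex ℝ Ξ) (y : 𝒳 → 𝒜 → Ξ → ℝ) (π : 𝒳 → stdSimplex ℝ 𝒜) :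
    robustValue εx εc P R y π =
      dualValue εx P fun x => ∑ a, π x a * dualValue εc (R x a) (y x a) := by
  simp only [robustValue, worstCaseExpectation_eq_dualValue hεx,
    worstCaseExpectation_eq_dualValue hεc]

/-- Every pair occurs in the dataset `D`, and in total variation the empirical distribution of the
contexts is within `s` of `P` and those of the outcomes are within `t` of the `R x a`. -/
structure IsAccurate {𝒳 𝒜 Ξ : Type*} [Fintype 𝒳] [Fintype Ξ] (D : Fin n → 𝒳 × 𝒜 × Ξ)
    (P : stdSimplex ℝ 𝒳) (R : 𝒳 → 𝒜 → stdSimplex ℝ Ξ) (s t : ℝ) : Prop where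
  pairCount_pos : ∀ x a, 0 < pairCount D x a
  tvDist_empContext_le : tvDist (empContext D) P ≤ s
  tvDist_empOutcome_le : ∀ x a, tvDist (empOutcome D x a) (R x a) ≤ t

theorem IsAccurate.abs_empRobustValue_sub_robustValue_le (h : IsAccurate D P R s t) (hn : 0 < n)
    (hεx : 0 < εx) (hεc : 0 < εc) (hY : 0 ≤ Y) (hy : ∀ x a ξ, y x a ξ ∈ Set.Icc 0 Y)
    (π : 𝒳 → stdSimplex ℝ 𝒜) :
    |empRobustValue εx εc D y π - robustValue εx εc P R y π| ≤ Y * (s + t) := by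
  have outcome_mem := fun x a => empOutcome_mem_stdSimplex (h.pairCount_pos x a)
  have context_error := abs_dualValue_sub_dualValue_le_tvDist hεx.le
    (empContext_mem_stdSimplex hn D) P.2
    fun x => sum_mul_dualValue_mem_Icc hεc.le (outcome_mem x) (hy x) (π x)
  have outcome_error : ∀ x a,
      |dualValue εc (empOutcome D x a) (y x a) - dualValue εc (R x a) (y x a)| ≤ Y * t :=
    fun x a => by
      have := abs_dualValue_sub_dualValue_le_tvDist hεc.le (outcome_mem x a) (R x a).2 (hy x a)
      rw [sub_zero] at this
      exact this.trans (mul_le_mul_of_nonneg_left (h.tvDist_empOutcome_le x a) hY)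
  rw [robustValue_eq_dualValue hεx hεc, mul_add]
  refine (abs_sub_le _ (dualValue εx P fun x =>
    ∑ a, π x a * dualValue εc (empOutcome D x a) (y x a)) _).trans (add_le_add ?_ ?_)
  · rw [sub_zero] at context_error
    exact context_error.trans (mul_le_mul_of_nonneg_left h.tvDist_empContext_le hY)
  · exact abs_dualValue_sub_dualValue_le hεx.le P.2 fun x =>
      abs_sum_mul_sub_sum_mul_le (π x).2 (outcome_error x)

theorem IsAccurate.abs_iInf_empRobustValue_sub_iInf_robustValue_le (h : IsAccurate D P R s t)
    (hn : 0 < n) (hεx : 0 < εx) (hεc : 0 < εc) (hY : 0 ≤ Y) (hy : ∀ x a ξ, y x a ξ ∈ Set.Icc 0 Y)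
    {Pol : Set (𝒳 → stdSimplex ℝ 𝒜)} (hPol : Pol.Nonempty) :
    |(⨅ π : Pol, empRobustValue εx εc D y π) - ⨅ π : Pol, robustValue εx εc P R y π|
      ≤ Y * (s + t) := by
  have := hPol.to_subtype
  refine abs_iInf_sub_iInf_le ⟨0, ?_⟩ ⟨0, ?_⟩ fun π =>
    h.abs_empRobustValue_sub_robustValue_le hn hεx hεc hY hy π
  · rintro _ ⟨π, rfl⟩
    exact (dualValue_mem_Icc hεx.le (empContext_mem_stdSimplex hn D) fun x =>
      sum_mul_dualValue_mem_Icc hεc.le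
        (fun a => empOutcome_mem_stdSimplex (h.pairCount_pos x a)) (hy x) (π.1 x)).1
  · rintro _ ⟨π, rfl⟩
    dsimp only
    rw [robustValue_eq_dualValue hεx hεc]
    exact (dualValue_mem_Icc hεx.le P.2 fun x =>
      sum_mul_dualValue_mem_Icc hεc.le (fun a => (R x a).2) (hy x) (π.1 x)).1

end RobustValue

section Concentration

theorem exp_indicator {Ω : Type*} (A : Set Ω) (f : Ω → ℝ) (ω : Ω) :
    Real.exp (A.indicator f ω) =
      A.indicator (fun ω => Real.exp (f ω)) ω + Aᶜ.indicator 1 ω := by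
  by_cases h : ω ∈ A <;> simp [h]

variable {Ω : Type*} [MeasurableSpace Ω] {μ : Measure Ω}

theorem restrict_eq_measure_smul_cond [IsFiniteMeasure μ] (A : Set Ω) :
    μ.restrict A = μ A • μ[|A] := by
  by_cases hA : μ A = 0
  · rw [hA, zero_smul, Measure.restrict_eq_zero.2 hA]
  · rw [ProbabilityTheory.cond, smul_smul, ENNReal.mul_inv_cancel hA (measure_ne_top μ A), one_smul]

section Indicator

variable {A B : Set Ω} {X : Ω → ℝ} {c : ℝ≥0}

theorem integrableOn_exp_of_hasSubgaussianMGF_cond [IsFiniteMeasure μ]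
    (hX : HasSubgaussianMGF X c μ[|A]) (t : ℝ) :
    IntegrableOn (fun ω => Real.exp (t * X ω - c * t ^ 2 / 2)) A μ := by
  rw [IntegrableOn, restrict_eq_measure_smul_cond]
  simp only [Real.exp_sub]
  exact ((hX.integrable_exp_mul t).div_const _).smul_measure (measure_ne_top μ A)

theorem setIntegral_exp_le_of_hasSubgaussianMGF_cond [IsFiniteMeasure μ]
    (hX : HasSubgaussianMGF X c μ[|A]) (t : ℝ) :
    ∫ ω in A, Real.exp (t * X ω - c * t ^ 2 / 2) ∂μ ≤ μ.real A := by
  rw [restrict_eq_measure_smul_cond, integral_smul_measure, smul_eq_mul]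
  refine mul_le_of_le_one_right measureReal_nonneg ?_
  simp only [Real.exp_sub, integral_div]
  exact div_le_one_of_le₀ (hX.mgf_le t) (Real.exp_pos _).le

theorem integrable_exp_indicator_of_hasSubgaussianMGF_cond [IsFiniteMeasure μ]
    (hA : MeasurableSet A) (hX : HasSubgaussianMGF X c μ[|A]) (t : ℝ) :
    Integrable (fun ω => Real.exp (A.indicator (fun ω => t * X ω - c * t ^ 2 / 2) ω)) μ := by
  simp only [exp_indicator]
  exact ((integrableOn_exp_of_hasSubgaussianMGF_cond hX t).integrable_indicator hA).add
    ((integrable_const 1).indicator hA.compl)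

theorem integral_exp_indicator_le_one_of_hasSubgaussianMGF_cond [IsProbabilityMeasure μ]
    (hA : MeasurableSet A) (hX : HasSubgaussianMGF X c μ[|A]) (t : ℝ) :
    ∫ ω, Real.exp (A.indicator (fun ω => t * X ω - c * t ^ 2 / 2) ω) ∂μ ≤ 1 := by
  simp only [exp_indicator]
  have integrable_compl : Integrable (Aᶜ.indicator (1 : Ω → ℝ)) μ :=
    (integrable_const 1).indicator hA.compl
  rw [integral_add ((integrableOn_exp_of_hasSubgaussianMGF_cond hX t).integrable_indicator hA)
    integrable_compl, integral_indicator hA, integral_indicator_one hA.compl]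
  calc _ ≤ μ.real A + μ.real Aᶜ := by
        gcongr; exact setIntegral_exp_le_of_hasSubgaussianMGF_cond hX t
    _ = 1 := probReal_add_probReal_compl hA

theorem hasSubgaussianMGF_indicator_sub_cond [IsFiniteMeasure μ] (hA : MeasurableSet A)
    (hB : MeasurableSet B) {ρ : ℝ} (hρ : μ.real (A ∩ B) = ρ * μ.real A) :
    HasSubgaussianMGF (fun ω => B.indicator 1 ω - ρ) (1 / 4) μ[|A] := by
  by_cases hμA : μ A = 0
  · rw [cond_eq_zero_of_meas_eq_zero hμA]
    exact ⟨by simp, by simp [mgf, Real.exp_nonneg]⟩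
  have := cond_isProbabilityMeasure (μ := μ) hμA
  have mean : ∫ ω, B.indicator 1 ω ∂μ[|A] = ρ := by
    rw [integral_indicator_one hB, measureReal_def, cond_apply hA, ENNReal.toReal_mul,
      ENNReal.toReal_inv, ← measureReal_def, ← measureReal_def, hρ]
    have : μ.real A ≠ 0 := (measureReal_ne_zero_iff).2 hμA
    field_simp
  have hoeffding := hasSubgaussianMGF_of_mem_Icc (μ := μ[|A]) (X := B.indicator 1) (a := 0) (b := 1)
    (measurable_one.indicator hB).aemeasurable
    (.of_forall fun ω => ⟨Set.indicator_nonneg (by simp) ω, Set.indicator_le_self' (by simp) ω⟩)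
  rw [mean] at hoeffding
  convert hoeffding using 1
  norm_num

end Indicator

theorem measureReal_sum_ge_le_exp_neg [IsFiniteMeasure μ] {ι : Type*} [Fintype ι] {W : ι → Ω → ℝ}
    (hW : ∀ i, Measurable (W i)) (hind : iIndepFun W μ)
    (hint : ∀ i, Integrable (fun ω => Real.exp (W i ω)) μ)
    (hle : ∀ i, ∫ ω, Real.exp (W i ω) ∂μ ≤ 1) (c : ℝ) :
    μ.real {ω | c ≤ ∑ i, W i ω} ≤ Real.exp (-c) := by
  have integrable_sum : Integrable (fun ω => Real.exp (1 * (∑ i, W i) ω)) μ :=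
    hind.integrable_exp_mul_sum hW fun i _ => by simpa only [one_mul] using hint i
  have mgf_sum_le : mgf (∑ i, W i) μ 1 ≤ 1 := by
    rw [hind.mgf_sum hW]
    refine Finset.prod_le_one (fun i _ => mgf_nonneg) fun i _ => ?_
    simpa only [mgf, one_mul] using hle i
  have chernoff := measure_ge_le_exp_mul_mgf c zero_le_one integrable_sum
  simp only [Finset.sum_apply, neg_mul, one_mul] at chernoff
  exact chernoff.trans (mul_le_of_le_one_right (Real.exp_pos _).le mgf_sum_le)

theorem sum_indicator_deviation {T : Type*} {n : ℕ} (D : Fin n → T) (E F : Set T) (u ρ v : ℝ) :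
    ∑ i, E.indicator (fun r => u * (F.indicator 1 r - ρ) - v) (D i) =
      u * hitCount D (E ∩ F) - (u * ρ + v) * hitCount D E := by
  simp only [natCast_hitCount, Finset.mul_sum, ← Finset.sum_sub_distrib]
  refine Finset.sum_congr rfl fun i _ => ?_
  by_cases hE : D i ∈ E <;> by_cases hF : D i ∈ F <;> simp [hE, hF] <;> ring

/- The number of records in `E` is random, but no conditioning on which records lie in `E` is
needed: those outside contribute the factor one to the exponential moment. -/
theorem measureReal_hitCount_inter_ge_le [IsProbabilityMeasure μ] {T : Type*} [MeasurableSpace T]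
    {n : ℕ} {D : Fin n → Ω → T} (hD : ∀ i, Measurable (D i)) (hind : iIndepFun D μ) {E F : Set T}
    (hE : MeasurableSet E) (hF : MeasurableSet F) {ρ t : ℝ} (ht : 0 ≤ t)
    (hρ : ∀ i, μ.real (D i ⁻¹' (E ∩ F)) = ρ * μ.real (D i ⁻¹' E)) (m : ℝ) :
    μ.real {ω | m ≤ hitCount (fun i => D i ω) E ∧
      (ρ + t) * hitCount (fun i => D i ω) E ≤ hitCount (fun i => D i ω) (E ∩ F)}
      ≤ Real.exp (-(2 * m * t ^ 2)) := by
  let w : T → ℝ :=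
    E.indicator fun r => 4 * t * (F.indicator 1 r - ρ) - ((1 / 4 : ℝ≥0) : ℝ) * (4 * t) ^ 2 / 2
  have hw : Measurable w :=
    (((measurable_one.indicator hF).sub_const ρ).const_mul _ |>.sub_const _).indicator hE
  have subgaussian := fun i => hasSubgaussianMGF_indicator_sub_cond (hD i hE) (hD i hF) (hρ i)
  refine (measureReal_mono fun ω hω => ?_).trans (measureReal_sum_ge_le_exp_neg
    (fun i => hw.comp (hD i)) (hind.comp (fun _ => w) fun _ => hw)
    (fun i => integrable_exp_indicator_of_hasSubgaussianMGF_cond (hD i hE) (subgaussian i) (4 * t))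
    (fun i => integral_exp_indicator_le_one_of_hasSubgaussianMGF_cond (hD i hE) (subgaussian i)
      (4 * t)) (2 * m * t ^ 2))
  obtain ⟨hm, hdev⟩ := hω
  change 2 * m * t ^ 2 ≤ ∑ i, w (D i ω)
  rw [sum_indicator_deviation]
  have := mul_le_mul_of_nonneg_left hdev ht
  have := mul_le_mul_of_nonneg_right hm (sq_nonneg t)
  push_cast
  nlinarith

end Concentration

section EmpiricalConcentration

variable {Ω : Type*} [MeasurableSpace Ω] {μ : Measure Ω} {T S : Type*} [MeasurableSpace T] {n : ℕ}
  {D : Fin n → Ω → T} {E : Set T}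

theorem sum_measureReal_inter_preimage_singleton [IsFiniteMeasure μ] [MeasurableSpace S]
    [MeasurableSingletonClass S] (A : Set Ω) {f : Ω → S} (hf : Measurable f) (B : Finset S) :
    ∑ s ∈ B, μ.real (A ∩ f ⁻¹' {s}) = μ.real (A ∩ f ⁻¹' B) := by
  have restrict_apply : ∀ C : Set S, MeasurableSet C →
      μ.real (A ∩ f ⁻¹' C) = (μ.restrict A).real (f ⁻¹' C) := fun C hC => by
    rw [measureReal_restrict_apply (hf hC), Set.inter_comm]
  simp only [restrict_apply _ B.measurableSet, restrict_apply _ (measurableSet_singleton _)]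
  exact sum_measureReal_preimage_singleton B fun s _ => hf (measurableSet_singleton s)

/-- The total variation radius within which the empirical distribution of `m` observations on a set
of `k` points lies of the true one, up to a failure probability `exp (-L)`. -/
noncomputable def tvRadius (k : ℕ) (L m : ℝ) : ℝ :=
  √((k * Real.log 2 + L) / (2 * m))

theorem two_pow_mul_exp_neg_tvRadius {L m : ℝ} (k : ℕ) (hL : 0 ≤ L) (hm : 0 < m) :
    2 ^ k * Real.exp (-(2 * m * tvRadius k L m ^ 2)) = Real.exp (-L) := by
  have := Real.log_nonneg one_le_two
  rw [tvRadius, Real.sq_sqrt (by positivity), mul_div_cancel₀ _ (by positivity), neg_add,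
    Real.exp_add, Real.exp_neg, Real.exp_nat_mul, Real.exp_log two_pos,
    mul_inv_cancel_left₀ (by positivity)]

theorem tvRadius_le {L m : ℝ} (k : ℕ) (hL : 0 ≤ L) (hm : 0 < m) :
    tvRadius k L m ≤ √(2 * L / m) + √(k / m) := by
  have log_two_le : Real.log 2 ≤ 2 := (Real.log_two_lt_d9.trans (by norm_num)).le
  have radicand_le : (k * Real.log 2 + L) / (2 * m) ≤ 2 * L / m + k / m := by
    rw [← add_div, div_le_div_iff₀ (by positivity) hm]
    have := mul_le_mul_of_nonneg_left log_two_le k.cast_nonneg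
    nlinarith
  refine Real.sqrt_le_iff.2 ⟨by positivity, radicand_le.trans ?_⟩
  rw [add_sq, Real.sq_sqrt (by positivity), Real.sq_sqrt (by positivity)]
  linarith [show 0 ≤ 2 * √(2 * L / m) * √(k / m) by positivity]

variable [IsProbabilityMeasure μ]

theorem measureReal_hitCount_le_le (hD : ∀ i, Measurable (D i)) (hind : iIndepFun D μ)
    (hE : MeasurableSet E) {p t : ℝ} (ht : 0 ≤ t) (hp : ∀ i, μ.real (D i ⁻¹' E) = p) :
    μ.real {ω | (hitCount (fun i => D i ω) E : ℝ) ≤ n * (p - t)} ≤ Real.exp (-(2 * n * t ^ 2)) := by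
  refine (measureReal_mono fun ω hω => ?_).trans (measureReal_hitCount_inter_ge_le hD hind
    .univ hE.compl (ρ := 1 - p) ht (fun i => ?_) n)
  · have split_count := hitCount_inter_add_hitCount_inter_compl (fun i => D i ω) Set.univ E
    simp only [Set.univ_inter, hitCount_univ] at split_count
    have split_count_real : (hitCount (fun i => D i ω) E : ℝ) + hitCount (fun i => D i ω) Eᶜ = n :=
      mod_cast split_count
    simp only [Set.mem_ofPred_eq, hitCount_univ, Set.univ_inter, le_refl, true_and] at hω ⊢
    linarith
  · simp only [Set.univ_inter, Set.preimage_compl, Set.preimage_univ, probReal_univ, mul_one,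
      probReal_compl_eq_one_sub (hD i hE), hp]

theorem measureReal_tvRadius_lt_tvDist_condFrequency_le [Fintype S] [MeasurableSpace S]
    [MeasurableSingletonClass S] (hD : ∀ i, Measurable (D i)) (hind : iIndepFun D μ)
    (hE : MeasurableSet E) {g : T → S} (hg : Measurable g) (q : stdSimplex ℝ S)
    (hqE : ∀ i s, μ.real (D i ⁻¹' (E ∩ g ⁻¹' {s})) = q s * μ.real (D i ⁻¹' E))
    {m L : ℝ} (hm : 0 < m) (hL : 0 ≤ L) :
    μ.real {ω | m ≤ hitCount (fun i => D i ω) E ∧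
      tvRadius (Fintype.card S) L m < tvDist (condFrequency (fun i => D i ω) E g) q}
      ≤ Real.exp (-L) := by
  set r := tvRadius (Fintype.card S) L m
  let deviation (A : Finset S) : Set Ω := {ω | m ≤ hitCount (fun i => D i ω) E ∧
    (∑ s ∈ A, q s + r) * hitCount (fun i => D i ω) E ≤
      hitCount (fun i => D i ω) (E ∩ g ⁻¹' A)}
  have deviation_le : ∀ A, μ.real (deviation A) ≤ Real.exp (-(2 * m * r ^ 2)) := fun A =>
    measureReal_hitCount_inter_ge_le hD hind hE (hg A.measurableSet) (Real.sqrt_nonneg _)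
      (fun i => by
        rw [Finset.sum_mul, Finset.sum_congr rfl fun s _ => (hqE i s).symm]
        exact (sum_measureReal_inter_preimage_singleton _ (hg.comp (hD i)) A).symm) m
  calc _ ≤ μ.real (⋃ A, deviation A) := measureReal_mono ?_
    _ ≤ ∑ _A : Finset S, Real.exp (-(2 * m * r ^ 2)) :=
        (measureReal_iUnion_fintype_le _).trans (Finset.sum_le_sum fun A _ => deviation_le A)
    _ = Real.exp (-L) := by
        rw [Finset.sum_const, Finset.card_univ, Fintype.card_finset, nsmul_eq_mul, Nat.cast_pow,
          Nat.cast_ofNat, two_pow_mul_exp_neg_tvRadius _ hL hm]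
  rintro ω ⟨hmE, hr⟩
  have count_pos : (0 : ℝ) < hitCount (fun i => D i ω) E := hm.trans_le hmE
  obtain ⟨A, hA⟩ := exists_sum_sub_sum_eq_tvDist
    (condFrequency_mem_stdSimplex (mod_cast count_pos) g) q.2
  have excess := hr.trans_eq hA.symm
  rw [sum_condFrequency, lt_sub_iff_add_lt', lt_div_iff₀ count_pos] at excess
  exact Set.mem_iUnion.2 ⟨A, hmE, excess.le⟩

end EmpiricalConcentration

section LoggedDataset

variable {Ω : Type*} [MeasurableSpace Ω] {μ : Measure Ω}
  {𝒳 𝒜 Ξ : Type*} [Fintype 𝒳] [MeasurableSpace 𝒳] [Fintype 𝒜] [MeasurableSpace 𝒜]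
  [Fintype Ξ] [MeasurableSpace Ξ]
  {P : stdSimplex ℝ 𝒳} {π₀ : 𝒳 → stdSimplex ℝ 𝒜} {R : 𝒳 → 𝒜 → stdSimplex ℝ Ξ} {n : ℕ}
  {D : Fin n → Ω → 𝒳 × 𝒜 × Ξ}

theorem IsLoggedDataset.measureReal_pairEvent_inter (hD : IsLoggedDataset μ P π₀ R D) (i : Fin n)
    (x : 𝒳) (a : 𝒜) (ξ : Ξ) :
    μ.real (D i ⁻¹' (pairEvent Ξ x a ∩ (fun r => r.2.2) ⁻¹' {ξ})) = P x * π₀ x a * R x a ξ := by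
  rw [← hD.law i x a ξ]
  congr 1
  ext ω
  simp [pairEvent, Prod.ext_iff, and_assoc]

variable [IsProbabilityMeasure μ] [MeasurableSingletonClass 𝒳] [MeasurableSingletonClass 𝒜]
  [MeasurableSingletonClass Ξ]

theorem IsLoggedDataset.measureReal_pairEvent (hD : IsLoggedDataset μ P π₀ R D) (i : Fin n)
    (x : 𝒳) (a : 𝒜) : μ.real (D i ⁻¹' pairEvent Ξ x a) = P x * π₀ x a := by
  have total := sum_measureReal_inter_preimage_singleton (μ := μ) (D i ⁻¹' pairEvent Ξ x a)
    ((measurable_of_countable fun r : 𝒳 × 𝒜 × Ξ => r.2.2).comp (hD.measurable i)) Finset.univ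
  simp only [Set.preimage_comp, ← Set.preimage_inter, hD.measureReal_pairEvent_inter,
    ← Finset.mul_sum, stdSimplex.sum_eq_one, mul_one, Finset.coe_univ, Set.preimage_univ,
    Set.inter_univ] at total
  exact total.symm

theorem IsLoggedDataset.measureReal_context (hD : IsLoggedDataset μ P π₀ R D) (i : Fin n) (x : 𝒳) :
    μ.real (D i ⁻¹' (Prod.fst ⁻¹' {x})) = P x := by
  have total := sum_measureReal_inter_preimage_singleton (μ := μ) (D i ⁻¹' (Prod.fst ⁻¹' {x}))
    ((measurable_of_countable fun r : 𝒳 × 𝒜 × Ξ => r.2.1).comp (hD.measurable i)) Finset.univ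
  have pairEvent_eq : ∀ a, Prod.fst ⁻¹' {x} ∩ (fun r : 𝒳 × 𝒜 × Ξ => r.2.1) ⁻¹' {a} =
      pairEvent Ξ x a := fun a => rfl
  simp only [Set.preimage_comp, ← Set.preimage_inter, pairEvent_eq, hD.measureReal_pairEvent,
    ← Finset.mul_sum, stdSimplex.sum_eq_one, mul_one, Finset.coe_univ, Set.preimage_univ,
    Set.inter_univ] at total
  exact total.symm

theorem IsLoggedDataset.measureReal_tvRadius_lt_tvDist_empContext_le
    (hD : IsLoggedDataset μ P π₀ R D) (hn : 0 < n) {L : ℝ} (hL : 0 ≤ L) :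
    μ.real {ω | tvRadius (Fintype.card 𝒳) L n < tvDist (empContext fun i => D i ω) P}
      ≤ Real.exp (-L) := by
  simpa only [hitCount_univ, le_refl, true_and, empContext_eq_condFrequency] using
    measureReal_tvRadius_lt_tvDist_condFrequency_le hD.measurable hD.indep .univ measurable_fst P
      (fun i x => by simpa using hD.measureReal_context i x) (Nat.cast_pos.2 hn) hL

theorem IsLoggedDataset.measureReal_tvRadius_lt_tvDist_empOutcome_le
    (hD : IsLoggedDataset μ P π₀ R D) (x : 𝒳) (a : 𝒜) {m L : ℝ} (hm : 0 < m) (hL : 0 ≤ L) :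
    μ.real {ω | m ≤ pairCount (fun i => D i ω) x a ∧
      tvRadius (Fintype.card Ξ) L m < tvDist (empOutcome (fun i => D i ω) x a) (R x a)}
      ≤ Real.exp (-L) := by
  simp only [pairCount_eq_hitCount, empOutcome_eq_condFrequency]
  exact measureReal_tvRadius_lt_tvDist_condFrequency_le hD.measurable hD.indep .of_discrete
    (measurable_of_countable _) (R x a)
    (fun i ξ => by rw [hD.measureReal_pairEvent_inter, hD.measureReal_pairEvent, mul_comm]) hm hL

theorem IsLoggedDataset.measureReal_pairCount_lt_le (hD : IsLoggedDataset μ P π₀ R D) (x : 𝒳)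
    (a : 𝒜) {κ : ℝ} (hκ : 0 ≤ κ) (hκx : κ ≤ P x * π₀ x a) :
    μ.real {ω | (pairCount (fun i => D i ω) x a : ℝ) < n * κ / 2} ≤
      Real.exp (-(n * κ ^ 2 / 2)) := by
  refine (measureReal_mono fun ω hω => ?_).trans
    ((measureReal_hitCount_le_le hD.measurable hD.indep .of_discrete (t := κ / 2) (by positivity)
      (hD.measureReal_pairEvent · x a)).trans_eq ?_)
  · have := mul_le_mul_of_nonneg_left hκx n.cast_nonneg
    simp only [Set.mem_ofPred_eq, pairCount_eq_hitCount] at hω ⊢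
    linarith
  · ring_nf

theorem IsLoggedDataset.measureReal_pairCount_lt_or_tvRadius_lt_tvDist_empOutcome_le
    (hD : IsLoggedDataset μ P π₀ R D) (hn : 0 < n) (x : 𝒳) (a : 𝒜) {κ L : ℝ} (hκ : 0 < κ)
    (hκx : κ ≤ P x * π₀ x a) (hL : 0 ≤ L) (hnL : 2 * L / κ ^ 2 ≤ n) :
    μ.real {ω | pairCount (fun i => D i ω) x a < n * κ / 2 ∨
      tvRadius (Fintype.card Ξ) L (n * κ / 2) < tvDist (empOutcome (fun i => D i ω) x a) (R x a)}
      ≤ 2 * Real.exp (-L) := by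
  have rare_pair := hD.measureReal_pairCount_lt_le x a hκ.le hκx
  have exponent_le : L ≤ n * κ ^ 2 / 2 := by
    rw [div_le_iff₀ (by positivity)] at hnL
    linarith
  have bad_outcome :=
    hD.measureReal_tvRadius_lt_tvDist_empOutcome_le x a (m := n * κ / 2) (by positivity) hL
  refine (measureReal_mono fun ω hω => ?_).trans
    ((measureReal_union_le _ _).trans ((add_le_add rare_pair bad_outcome).trans ?_))
  · rcases lt_or_ge (pairCount (fun i => D i ω) x a : ℝ) (n * κ / 2) with hlt | hge
    · exact .inl hlt
    · exact .inr ⟨hge, hω.resolve_left hge.not_gt⟩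
  · linarith [Real.exp_le_exp.2 (neg_le_neg exponent_le)]

theorem IsLoggedDataset.one_sub_le_measureReal_isAccurate (hD : IsLoggedDataset μ P π₀ R D)
    (hn : 0 < n) {κ L M : ℝ} (hκ : 0 < κ) (hκP : ∀ x a, κ ≤ P x * π₀ x a) (hL : 0 ≤ L)
    (hM : 0 ≤ M) (hnM : 2 * M / κ ^ 2 ≤ n) :
    1 - (Real.exp (-L) + Fintype.card 𝒳 * Fintype.card 𝒜 * (2 * Real.exp (-M))) ≤
      μ.real {ω | IsAccurate (fun i => D i ω) P R (tvRadius (Fintype.card 𝒳) L n)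
        (tvRadius (Fintype.card Ξ) M (n * κ / 2))} := by
  set s := tvRadius (Fintype.card 𝒳) L n
  set t := tvRadius (Fintype.card Ξ) M (n * κ / 2)
  set accurate : Set Ω := {ω | IsAccurate (fun i => D i ω) P R s t}
  let badContext : Set Ω := {ω | s < tvDist (empContext fun i => D i ω) P}
  let badPair (p : 𝒳 × 𝒜) : Set Ω := {ω | pairCount (fun i => D i ω) p.1 p.2 < n * κ / 2 ∨
    t < tvDist (empOutcome (fun i => D i ω) p.1 p.2) (R p.1 p.2)}
  have cover : Set.univ ⊆ accurate ∪ (badContext ∪ ⋃ p, badPair p) := fun ω _ => by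
    by_contra hω
    simp only [Set.mem_union, not_or, Set.mem_iUnion, not_exists, accurate, badContext, badPair,
      Set.mem_ofPred_eq, not_lt] at hω
    obtain ⟨not_accurate, context_le, pair_le⟩ := hω
    refine not_accurate ⟨fun x a => ?_, context_le, fun x a => (pair_le (x, a)).2⟩
    exact_mod_cast (show 0 < n * κ / 2 by positivity).trans_le (pair_le (x, a)).1
  have badPairs_le : μ.real (⋃ p, badPair p) ≤
      Fintype.card 𝒳 * Fintype.card 𝒜 * (2 * Real.exp (-M)) := by
    refine (measureReal_iUnion_fintype_le _).trans ((Finset.sum_le_sum fun p _ =>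
      hD.measureReal_pairCount_lt_or_tvRadius_lt_tvDist_empOutcome_le hn p.1 p.2 hκ
        (hκP p.1 p.2) hM hnM).trans_eq ?_)
    simp
  have badContext_le : μ.real badContext ≤ Real.exp (-L) :=
    hD.measureReal_tvRadius_lt_tvDist_empContext_le hn hL
  have total : 1 ≤ μ.real accurate + (μ.real badContext + μ.real (⋃ p, badPair p)) := by
    rw [← probReal_univ (μ := μ)]
    refine (measureReal_mono cover).trans ((measureReal_union_le _ _).trans ?_)
    gcongr
    exact measureReal_union_le _ _
  linarith

end LoggedDataset

end WassersteinOPL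

theorem mainTheorem2_general
    {𝒳 𝒜 Ξ : Type*} [Fintype 𝒳] [PseudoMetricSpace 𝒳] [MeasurableSpace 𝒳]
    [MeasurableSingletonClass 𝒳] [Fintype 𝒜] [MeasurableSpace 𝒜] [MeasurableSingletonClass 𝒜]
    [Fintype Ξ] [PseudoMetricSpace Ξ] [MeasurableSpace Ξ] [MeasurableSingletonClass Ξ]
    (P : stdSimplex ℝ 𝒳) (π₀ : 𝒳 → stdSimplex ℝ 𝒜) (R : 𝒳 → 𝒜 → stdSimplex ℝ Ξ)
    (y : 𝒳 → 𝒜 → Ξ → ℝ) (Ymax κ εx εc δ : ℝ)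
    (hκ : 0 < κ) (hκP : ∀ x a, κ ≤ P x * π₀ x a)
    (hy : ∀ x a ξ, y x a ξ ∈ Set.Icc 0 Ymax)
    (hεx : 0 < εx) (hεc : 0 < εc) (hδ : 0 < δ) (hδ' : δ < 1)
    {Ω : Type*} [MeasurableSpace Ω] (μ : Measure Ω) [IsProbabilityMeasure μ]
    (n : ℕ) (D : Fin n → Ω → 𝒳 × 𝒜 × Ξ) (hD : WassersteinOPL.IsLoggedDataset μ P π₀ R D)
    (hn : 2 * Real.log (4 * Fintype.card 𝒳 * Fintype.card 𝒜 / δ) / κ ^ 2 ≤ n)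
    (Pol : Set (𝒳 → stdSimplex ℝ 𝒜)) (hPol : Pol.Nonempty) :
    1 - δ ≤ μ.real {ω |
      (∀ x a, 0 < WassersteinOPL.pairCount (fun i => D i ω) x a) ∧
      |(⨅ π : Pol, WassersteinOPL.empRobustValue εx εc (fun i => D i ω) y π)
          - ⨅ π : Pol, WassersteinOPL.robustValue εx εc P R y π|
        ≤ Ymax * (√(2 * Real.log (2 / δ) / n) + √(Fintype.card 𝒳 / n)
            + √(4 * Real.log (4 * Fintype.card 𝒳 * Fintype.card 𝒜 / δ) / (n * κ))
            + √(2 * Fintype.card Ξ / (n * κ)))} := by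
  obtain ⟨x₀⟩ := WassersteinOPL.nonempty_of_stdSimplex P
  obtain ⟨a₀⟩ := WassersteinOPL.nonempty_of_stdSimplex (π₀ x₀)
  obtain ⟨ξ₀⟩ := WassersteinOPL.nonempty_of_stdSimplex (R x₀ a₀)
  have Ymax_nonneg : 0 ≤ Ymax := (hy x₀ a₀ ξ₀).1.trans (hy x₀ a₀ ξ₀).2
  have card_context : (1 : ℝ) ≤ Fintype.card 𝒳 := mod_cast Fintype.card_pos_iff.2 ⟨x₀⟩
  have card_action : (1 : ℝ) ≤ Fintype.card 𝒜 := mod_cast Fintype.card_pos_iff.2 ⟨a₀⟩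
  have one_lt_pairs : 1 < 4 * Fintype.card 𝒳 * Fintype.card 𝒜 / δ := by
    rw [lt_div_iff₀ hδ]
    nlinarith
  set M := Real.log (4 * Fintype.card 𝒳 * Fintype.card 𝒜 / δ) with hM
  have M_pos : 0 < M := Real.log_pos one_lt_pairs
  have log_nonneg : 0 ≤ Real.log (2 / δ) := Real.log_nonneg (by rw [le_div_iff₀ hδ]; linarith)
  have n_pos : (0 : ℝ) < n := lt_of_lt_of_le (by positivity) hn
  have failure : Real.exp (-Real.log (2 / δ)) +
      Fintype.card 𝒳 * Fintype.card 𝒜 * (2 * Real.exp (-M)) = δ := by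
    rw [Real.exp_neg, Real.exp_neg, hM, Real.exp_log (by positivity), Real.exp_log (by positivity)]
    field_simp
    norm_num
  have radius_context := WassersteinOPL.tvRadius_le (Fintype.card 𝒳) log_nonneg n_pos
  have radius_outcome := WassersteinOPL.tvRadius_le (m := n * κ / 2) (Fintype.card Ξ) M_pos.le
    (by positivity)
  have accurate := hD.one_sub_le_measureReal_isAccurate (mod_cast n_pos) hκ hκP log_nonneg
    M_pos.le hn
  rw [failure] at accurate
  refine accurate.trans (measureReal_mono fun ω h => ⟨h.pairCount_pos,
    (h.abs_iInf_empRobustValue_sub_iInf_robustValue_le (mod_cast n_pos) hεx hεc Ymax_nonneg hy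
      hPol).trans (mul_le_mul_of_nonneg_left ?_ Ymax_nonneg)⟩)
  rw [show 2 * M / (n * κ / 2) = 4 * M / (n * κ) by field_simp; norm_num,
    show Fintype.card Ξ / (n * κ / 2) = 2 * Fintype.card Ξ / (n * κ) by field_simp]
    at radius_outcome
  linarith

theorem mainTheorem2
    {d d' : ℕ} (𝒳 : Finset (EuclideanSpace ℝ (Fin d))) (Ξ : Finset (EuclideanSpace ℝ (Fin d')))
    {𝒜 : Type*} [Fintype 𝒜] [MeasurableSpace 𝒜] [MeasurableSingletonClass 𝒜]
    (P : stdSimplex ℝ 𝒳) (π₀ : 𝒳 → stdSimplex ℝ 𝒜) (R : 𝒳 → 𝒜 → stdSimplex ℝ Ξ)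
    (y : 𝒳 → 𝒜 → Ξ → ℝ)
    (Ymax μπ μx εx εc δ : ℝ)
    (hμπ : 0 < μπ) (hπ₀ : ∀ x a, μπ ≤ π₀ x a)
    (hμx : 0 < μx) (hP : ∀ x, μx ≤ P x)
    (hy : ∀ x a ξ, 0 ≤ y x a ξ ∧ y x a ξ ≤ Ymax)
    (hεx : 0 < εx) (hεc : 0 < εc) (hδ : 0 < δ) (hδ' : δ < 1)
    {Ω : Type*} [MeasurableSpace Ω] (μ : Measure Ω) [IsProbabilityMeasure μ]
    (n : ℕ) (D : Fin n → Ω → 𝒳 × 𝒜 × Ξ)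
    (hD : WassersteinOPL.IsLoggedDataset μ P π₀ R D)
    (hn : 2 * Real.log (4 * 𝒳.card * Fintype.card 𝒜 / δ) / (μπ * μx) ^ 2 ≤ n)
    (Pol : Set (𝒳 → stdSimplex ℝ 𝒜)) (hPol : Pol.Nonempty) :
    1 - δ ≤ μ.real {ω |
      (∀ x a, 0 < WassersteinOPL.pairCount (fun i => D i ω) x a) ∧
      |(⨅ π : Pol, WassersteinOPL.empRobustValue εx εc (fun i => D i ω) y π)
          - ⨅ π : Pol, WassersteinOPL.robustValue εx εc P R y π|
        ≤ Ymax * (√(2 * Real.log (2 / δ) / n) + √(𝒳.card / n)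
            + √(4 * Real.log (4 * 𝒳.card * Fintype.card 𝒜 / δ) / (n * μπ * μx))
            + √(2 * Ξ.card / (n * μπ * μx)))} := by
  simpa only [Fintype.card_coe, mul_assoc] using
    mainTheorem2_general P π₀ R y Ymax (μπ * μx) εx εc δ (mul_pos hμπ hμx)
      (fun x a => mul_comm μπ μx ▸ mul_le_mul (hP x) (hπ₀ x a) hμπ.le (hμx.le.trans (hP x)))
      hy hεx hεc hδ hδ' μ n D hD
      (by rwa [Fintype.card_coe]) Pol hPol
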